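/- Let $n\ge 2$ be an integer and let $w\ge\sqrt2$ be a real number. Let $A(w)$ be the $n\times n$ adjacency matrix of the path on vertices $1,2,\dots,n$ with a loop of weight $w$ added at each of the two end vertices; that is, $A(w)_{j,j+1}=A(w)_{j+1,j}=1$ for $1\le j\le n-1$, $A(w)_{1,1}=A(w)_{n,n}=w$, and all other entries are $0$. Let $\lambda_1\ge\lambda_2\ge\dots\ge\lambda_n$ be the eigenvalues of $A(w)$, listed with multiplicity. For $t\in\mathbb R$ let $$p(t)=\bigl|\bigl(e^{itA(w)}\bigr)_{1,n}\bigr|^2$$ be the fidelity of state transfer from vertex $1$ to vertex $n$ at readout time $t$, and let $$\tau_n=\frac{(w+1)^2(w-1)}{w\left(w^{2\lceil n/2\rceil}-1\right)}.$$ Suppose that $w+\frac1w-\tau_n\ge 2$, and let $k\ge 0$ be an integer. Then $\lambda_1>\lambda_2$, and $$p\!\left(\frac{(2k+1)\pi}{\lambda_1-\lambda_2}\right)\ \ge\ \left(\frac{w^2-2}{w^2}\right)^2 .$$ -/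

import Mathlib

noncomputable section

namespace LoopedPath

open Classical in
/-- Adjacency matrix of the path on the `n` vertices `0, 1, …, n - 1` with a loop of weight `w`
at each of the two end vertices `0` and `n - 1`. -/
def adj (n : ℕ) (w : ℝ) : Matrix (Fin n) (Fin n) ℝ := fun i j =>
  if (SimpleGraph.pathGraph n).Adj i j then 1
  else if i = j ∧ ((i : ℕ) = 0 ∨ (i : ℕ) + 1 = n) then w
  else 0

theorem adj_isHermitian (n : ℕ) (w : ℝ) : (adj n w).IsHermitian := by
  ext i j
  rcases eq_or_ne i j with rfl | h
  · simp [adj]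
  · by_cases hij : (SimpleGraph.pathGraph n).Adj i j
    · simp [adj, hij, hij.symm]
    · have hji : ¬ (SimpleGraph.pathGraph n).Adj j i := fun h' => hij h'.symm
      simp [adj, h, h.symm, hij, hji]

/-- The eigenvalues of `adj n w`, with multiplicity, in nonincreasing order
(indexed from `0`, so that `eigenvalue n w 0` is the largest one). -/
def eigenvalue (n : ℕ) (w : ℝ) (j : Fin n) : ℝ :=
  (adj_isHermitian n w).eigenvalues₀ (Fin.cast (Fintype.card_fin n).symm j)

/-- The transition matrix `U(t) = exp (i t A(w))`. -/
def transition (n : ℕ) (w t : ℝ) : Matrix (Fin n) (Fin n) ℂ :=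
  NormedSpace.exp ((Complex.I * (t : ℂ)) • (adj n w).map (fun x : ℝ => (x : ℂ)))

/-- The fidelity `|U(t)_{a,b}|²` of state transfer from vertex `a` to vertex `b` at time `t`. -/
def fidelity (n : ℕ) (w : ℝ) (a b : Fin n) (t : ℝ) : ℝ :=
  ‖transition n w t a b‖ ^ 2

/-- `τ_n = (w + 1)² (w - 1) / (w (w ^ (2⌈n/2⌉) - 1))`. -/
def tau (n : ℕ) (w : ℝ) : ℝ :=
  (w + 1) ^ 2 * (w - 1) / (w * (w ^ (2 * ⌈(n : ℝ) / 2⌉₊) - 1))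

end LoopedPath

end

namespace LoopedPath

/-! Throughout, `n = m + 2`. Let `p` and `q` be the squared first entries of the unit eigenvectors
of the two largest eigenvalues, the first vector symmetric and the second antisymmetric. At the
readout times their phases are opposite, which cancels the opposite signs at the far end, so
together they contribute modulus `p + q` to the transition amplitude. The other eigenvectors
contribute at most `1 - (p + q)`, so the amplitude is at least `2 (p + q) - 1`
(`fidelity_lower_bound`), and it suffices that `p + q ≥ c`, where `c = 1 - 1 / w ^ 2`.

Eigenvalues above `2` are `x + x⁻¹` with `x > 1` a root of a symmetric or antisymmetric equation
(`IsRoot`); let `x` and `y` give the top two, so `y < w < x`. Then `c / (2p)` and `c / (2q)` are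
explicit functions `symRatio` at `x` and `antiRatio` at `y`. Their sum at a common point is at most
`2` (`symRatio_add_antiRatio_le`), and `antiRatio` is increasing (`antiRatio_mono`), being `1` plus
the derivative of a convex function of the eigenvalue. Hence `c / (2p) + c / (2q) ≤ 2`, and the
arithmetic-harmonic mean inequality gives `p + q ≥ c` (`one_sub_le_sum_of_isRoot`).

An antisymmetric root `y > 1` exists once `m + 3 < w (m + 1)`, which holds for `n ≥ 4`
(`lt_of_tau`); `n = 2` and `n = 3` are computed by hand. -/

/-! ### Eigenvectors as solutions of a three-term recurrence -/

/-- The three kinds of rows of `adj (m + 2) w *ᵥ V = μ • V` for a sequence `V`. -/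
def IsEigenseq (m : ℕ) (w μ : ℝ) (V : ℕ → ℝ) : Prop :=
  w * V 0 + V 1 = μ * V 0 ∧ (∀ i < m, V i + V (i + 2) = μ * V (i + 1)) ∧
    V m + w * V (m + 1) = μ * V (m + 1)

theorem adj_mulVec_first (m : ℕ) (w : ℝ) (V : ℕ → ℝ) :
    (adj (m + 2) w).mulVec (fun i => V i) ⟨0, by omega⟩ = w * V 0 + V 1 := by
  rw [Matrix.mulVec, dotProduct, Fintype.sum_eq_add (⟨0, by omega⟩ : Fin (m + 2)) ⟨1, by omega⟩]
  · simp [adj, SimpleGraph.pathGraph_adj]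
  · simp
  · rintro ⟨j, hj⟩ ⟨h0, h1⟩
    simp only [ne_eq, Fin.mk.injEq] at h0 h1
    have : ¬ (1 = j) := fun h => h1 h.symm
    have : ¬ (0 = j) := fun h => h0 h.symm
    simp [adj, SimpleGraph.pathGraph_adj, *]

theorem adj_mulVec_last (m : ℕ) (w : ℝ) (V : ℕ → ℝ) :
    (adj (m + 2) w).mulVec (fun i => V i) ⟨m + 1, by omega⟩ = V m + w * V (m + 1) := by
  rw [Matrix.mulVec, dotProduct,
    Fintype.sum_eq_add (⟨m, by omega⟩ : Fin (m + 2)) ⟨m + 1, by omega⟩]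
  · simp [adj, SimpleGraph.pathGraph_adj]
  · simp
  · rintro ⟨j, hj⟩ ⟨h0, h1⟩
    simp only [ne_eq, Fin.mk.injEq] at h0 h1
    have : ¬ (m + 1 = j) := fun h => h1 h.symm
    have : ¬ (m + 1 + 1 = j) := by omega
    simp [adj, SimpleGraph.pathGraph_adj, *]

theorem adj_mulVec_mid (m : ℕ) (w : ℝ) (V : ℕ → ℝ) (i : ℕ) (hi : i < m) :
    (adj (m + 2) w).mulVec (fun i => V i) ⟨i + 1, by omega⟩ = V i + V (i + 2) := by
  rw [Matrix.mulVec, dotProduct,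
    Fintype.sum_eq_add (⟨i, by omega⟩ : Fin (m + 2)) ⟨i + 2, by omega⟩]
  · simp [adj, SimpleGraph.pathGraph_adj]
  · simp
  · rintro ⟨j, hj⟩ ⟨h0, h1⟩
    simp only [ne_eq, Fin.mk.injEq] at h0 h1
    have : ¬ (i + 1 + 1 = j) := fun h => h1 h.symm
    have : ¬ (i = m) := by omega
    simp [adj, SimpleGraph.pathGraph_adj, *]

theorem adj_mulVec_eq_smul_iff (m : ℕ) (w μ : ℝ) (V : ℕ → ℝ) :
    (adj (m + 2) w).mulVec (fun i => V i) = μ • (fun i : Fin (m + 2) => V i) ↔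
      IsEigenseq m w μ V := by
  constructor
  · intro h
    refine ⟨?_, fun i hi => ?_, ?_⟩
    · rw [← adj_mulVec_first m w V, h]; simp
    · rw [← adj_mulVec_mid m w V i hi, h]; simp
    · rw [← adj_mulVec_last m w V, h]; simp
  · rintro ⟨h0, h1, h2⟩
    ext ⟨i, hi⟩
    rcases i with _ | i
    · exact (adj_mulVec_first m w V).trans h0
    · rcases Nat.lt_or_ge i m with h | h
      · exact (adj_mulVec_mid m w V i h).trans (h1 i h)
      · obtain rfl : i = m := by omega
        exact (adj_mulVec_last i w V).trans h2

/-- The extension by zero of a vector to a sequence. -/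
def extend {n : ℕ} (v : Fin n → ℝ) (j : ℕ) : ℝ := if h : j < n then v ⟨j, h⟩ else 0

theorem extend_val {n : ℕ} (v : Fin n → ℝ) : (fun i : Fin n => extend v i) = v := by
  ext i; simp [extend]

theorem isEigenseq_extend {m : ℕ} {w μ : ℝ} {v : Fin (m + 2) → ℝ}
    (h : (adj (m + 2) w).mulVec v = μ • v) : IsEigenseq m w μ (extend v) := by
  rw [← adj_mulVec_eq_smul_iff, extend_val, h]

/-- The recurrence determines a solution from its first entry, so eigenspaces are lines. -/
theorem IsEigenseq.proportional {m : ℕ} {w μ : ℝ} {U V : ℕ → ℝ} (hU : IsEigenseq m w μ U)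
    (hV : IsEigenseq m w μ V) : ∀ j < m + 2, U 0 * V j = V 0 * U j := by
  intro j
  induction j using Nat.strong_induction_on with
  | _ j ih =>
    intro hj
    rcases j with _ | _ | j
    · ring
    · linear_combination U 0 * hV.1 - V 0 * hU.1
    · linear_combination U 0 * hV.2.1 j (by omega) - V 0 * hU.2.1 j (by omega)
        + μ * ih (j + 1) (by omega) (by omega) - ih j (by omega) (by omega)

theorem eigenvector_proportional {m : ℕ} {w μ : ℝ} {u v : Fin (m + 2) → ℝ}
    (hu : (adj (m + 2) w).mulVec u = μ • u) (hv : (adj (m + 2) w).mulVec v = μ • v)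
    (j : Fin (m + 2)) : u 0 * v j = v 0 * u j := by
  have := (isEigenseq_extend hu).proportional (isEigenseq_extend hv) j j.2
  simpa [extend] using this

theorem eigenvector_zero_ne {m : ℕ} {w μ : ℝ} {v : Fin (m + 2) → ℝ}
    (hv : (adj (m + 2) w).mulVec v = μ • v) (h : v ≠ 0) : v 0 ≠ 0 := by
  contrapose! h
  have he := isEigenseq_extend hv
  have h0 : extend v 0 = 0 := by simpa [extend] using h
  have hall : ∀ k < m + 2, extend v k = 0 := by
    intro k
    induction k using Nat.strong_induction_on with
    | _ k ih =>
      intro hk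
      rcases k with _ | _ | k
      · exact h0
      · linear_combination he.1 + (μ - w) * h0
      · linear_combination he.2.1 k (by omega) + μ * ih (k + 1) (by omega) (by omega)
          - ih k (by omega) (by omega)
  ext k
  simpa [extend] using hall k k.2


/-! ### Spectral expansion, simplicity and ordering of the eigenvalues -/

theorem exp_smul_map_apply {n : ℕ} {A : Matrix (Fin n) (Fin n) ℝ} (hA : A.IsHermitian) (c : ℂ)
    (a b : Fin n) :
    (NormedSpace.exp (c • A.map (fun x : ℝ => (x : ℂ))) : Matrix (Fin n) (Fin n) ℂ) a b =
      ∑ j, Complex.exp (c * hA.eigenvalues j) *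
        ((hA.eigenvectorBasis j a * hA.eigenvectorBasis j b : ℝ) : ℂ) := by
  set U : Matrix (Fin n) (Fin n) ℝ := (hA.eigenvectorUnitary : Matrix (Fin n) (Fin n) ℝ) with hU
  have hUU : U * star U = 1 := Unitary.coe_mul_star_self hA.eigenvectorUnitary
  have hA' : A = U * Matrix.diagonal hA.eigenvalues * star U := by
    conv_lhs => rw [hA.spectral_theorem]
    rw [Unitary.conjStarAlgAut_apply]
    rfl
  let f : ℝ →+* ℂ := Complex.ofRealHom
  have hmap : U.map f * (star U).map f = 1 := by
    rw [← Matrix.map_mul, hUU, Matrix.map_one f (map_zero f) (map_one f)]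
  have hinv : (U.map f)⁻¹ = (star U).map f := Matrix.inv_eq_right_inv hmap
  have hunit : IsUnit (U.map f) := IsUnit.of_mul_eq_one _ hmap
  have hAc : c • A.map (fun x : ℝ => (x : ℂ)) =
      U.map f * Matrix.diagonal (fun j => c * (hA.eigenvalues j : ℂ)) * (U.map f)⁻¹ := by
    have : A.map (fun x : ℝ => (x : ℂ)) =
        U.map f * Matrix.diagonal (fun j => (hA.eigenvalues j : ℂ)) * (star U).map f := by
      conv_lhs => rw [hA']
      change Matrix.map _ f = _
      rw [Matrix.map_mul, Matrix.map_mul, Matrix.diagonal_map (map_zero f)]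
      rfl
    rw [this, hinv, ← Matrix.smul_mul, ← Matrix.mul_smul, ← Matrix.diagonal_smul]
    rfl
  rw [hAc, Matrix.exp_conj _ _ hunit, Matrix.exp_diagonal, hinv, Matrix.mul_apply]
  refine Finset.sum_congr rfl fun j _ => ?_
  rw [Matrix.mul_diagonal]
  simp only [hU, Matrix.map_apply, Matrix.star_apply, Matrix.IsHermitian.eigenvectorUnitary_apply,
    f, Complex.ofRealHom_eq_coe, Complex.ofReal_mul, star_trivial]
  rw [Pi.coe_exp, ← Complex.exp_eq_exp_ℂ]
  ring

theorem sum_eigenvectorBasis_sq {n : ℕ} {A : Matrix (Fin n) (Fin n) ℝ} (hA : A.IsHermitian)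
    (a : Fin n) : ∑ j, hA.eigenvectorBasis j a ^ 2 = 1 := by
  have hUU : (hA.eigenvectorUnitary : Matrix (Fin n) (Fin n) ℝ) *
      star (hA.eigenvectorUnitary : Matrix (Fin n) (Fin n) ℝ) = 1 :=
    Unitary.coe_mul_star_self hA.eigenvectorUnitary
  have := congrFun (congrFun hUU a) a
  simp only [Matrix.mul_apply, Matrix.star_apply, Matrix.IsHermitian.eigenvectorUnitary_apply,
    star_trivial, Matrix.one_apply_eq] at this
  simpa only [sq] using this

theorem sum_sq_eigenvectorBasis {n : ℕ} {A : Matrix (Fin n) (Fin n) ℝ} (hA : A.IsHermitian)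
    (j : Fin n) : ∑ a, hA.eigenvectorBasis j a ^ 2 = 1 := by
  have := hA.eigenvectorBasis.orthonormal.1 j
  rw [EuclideanSpace.norm_eq, Real.sqrt_eq_one] at this
  simpa using this

theorem eigenvectorBasis_ne_zero {n : ℕ} {A : Matrix (Fin n) (Fin n) ℝ} (hA : A.IsHermitian)
    (j : Fin n) : (fun a => hA.eigenvectorBasis j a) ≠ 0 := by
  intro h
  have h4 := sum_sq_eigenvectorBasis hA j
  rw [Finset.sum_eq_zero fun a _ => by rw [congrFun h a]; simp] at h4
  exact zero_ne_one h4

theorem exists_eigenvalues_eq {n : ℕ} {A : Matrix (Fin n) (Fin n) ℝ} (hA : A.IsHermitian)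
    {μ : ℝ} {v : Fin n → ℝ} (hv : A.mulVec v = μ • v) (h0 : v ≠ 0) :
    ∃ j, hA.eigenvalues j = μ := by
  have h : Module.End.HasEigenvalue (Matrix.toLin' A) μ :=
    Module.End.hasEigenvalue_of_hasEigenvector (x := v)
      ⟨Module.End.mem_eigenspace_iff.2 (by simpa using hv), h0⟩
  have h2 := h.mem_spectrum
  rw [Matrix.spectrum_toLin', hA.spectrum_real_eq_range_eigenvalues] at h2
  exact h2

theorem mulVec_eigenvectorBasis_adj (n : ℕ) (w : ℝ) (j : Fin n) :
    (adj n w).mulVec (fun a => (adj_isHermitian n w).eigenvectorBasis j a) =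
      (adj_isHermitian n w).eigenvalues j •
        (fun a => (adj_isHermitian n w).eigenvectorBasis j a) :=
  (adj_isHermitian n w).mulVec_eigenvectorBasis j

/-- Basis vectors sharing an eigenvalue would be both proportional and orthogonal. -/
theorem eigenvalues_adj_injective (m : ℕ) (w : ℝ) :
    Function.Injective (adj_isHermitian (m + 2) w).eigenvalues := by
  intro i j hij
  by_contra hne
  set b := (adj_isHermitian (m + 2) w).eigenvectorBasis
  have hi := mulVec_eigenvectorBasis_adj (m + 2) w i
  have hj := mulVec_eigenvectorBasis_adj (m + 2) w j
  rw [hij] at hi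
  have hp := eigenvector_proportional hi hj
  have horth : ∑ a, b i a * b j a = 0 := by
    have := b.orthonormal.2 (Ne.symm hne)
    simpa [PiLp.inner_apply] using this
  have h1 := sum_sq_eigenvectorBasis (adj_isHermitian (m + 2) w) i
  have h2 : b j 0 = 0 := by
    have : b j 0 * ∑ a, b i a ^ 2 = b i 0 * ∑ a, b i a * b j a := by
      rw [Finset.mul_sum, Finset.mul_sum]
      refine Finset.sum_congr rfl fun a _ => ?_
      linear_combination (-b i a) * hp a
    rw [horth, h1] at this
    linarith
  exact eigenvector_zero_ne hj (eigenvectorBasis_ne_zero _ j) h2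

theorem eigenvalue_strictAnti (m : ℕ) (w : ℝ) : StrictAnti (eigenvalue (m + 2) w) := by
  have hinj : Function.Injective (adj_isHermitian (m + 2) w).eigenvalues₀ := by
    intro i j hij
    have h := eigenvalues_adj_injective m w
    have he := @h (Fintype.equivOfCardEq (Fintype.card_fin _) i)
      (Fintype.equivOfCardEq (Fintype.card_fin _) j)
    simp only [Matrix.IsHermitian.eigenvalues, Equiv.symm_apply_apply] at he
    exact (Fintype.equivOfCardEq (Fintype.card_fin _)).injective (he hij)
  intro i j hij
  exact (adj_isHermitian (m + 2) w).eigenvalues₀_antitone.strictAnti_of_injective hinj hij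

theorem exists_eigenvalue_eq (m : ℕ) (w : ℝ) (j : Fin (m + 2)) :
    ∃ i, (adj_isHermitian (m + 2) w).eigenvalues j = eigenvalue (m + 2) w i :=
  ⟨Fin.cast (Fintype.card_fin _) ((Fintype.equivOfCardEq (Fintype.card_fin _)).symm j), rfl⟩

theorem exists_eigenvalues_eq_eigenvalue (m : ℕ) (w : ℝ) (i : Fin (m + 2)) :
    ∃ j, (adj_isHermitian (m + 2) w).eigenvalues j = eigenvalue (m + 2) w i :=
  ⟨Fintype.equivOfCardEq (Fintype.card_fin _) (Fin.cast (Fintype.card_fin _).symm i), by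
    simp [Matrix.IsHermitian.eigenvalues, eigenvalue]⟩

theorem eigenvalue_zero_one {m : ℕ} {w l₁ l₂ : ℝ} {z y : Fin (m + 2) → ℝ}
    (hz : (adj (m + 2) w).mulVec z = l₁ • z) (hy : (adj (m + 2) w).mulVec y = l₂ • y)
    (hz0 : z ≠ 0) (hy0 : y ≠ 0) (hl : l₂ < l₁)
    (hμ : ∀ μ v, (adj (m + 2) w).mulVec v = μ • v → v ≠ 0 → μ = l₁ ∨ μ ≤ l₂) :
    eigenvalue (m + 2) w 0 = l₁ ∧ eigenvalue (m + 2) w 1 = l₂ := by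
  have hanti := eigenvalue_strictAnti m w
  have hmem : ∀ i, eigenvalue (m + 2) w i = l₁ ∨ eigenvalue (m + 2) w i ≤ l₂ := by
    intro i
    obtain ⟨j, hj⟩ := exists_eigenvalues_eq_eigenvalue m w i
    rw [← hj]
    exact hμ _ _ (mulVec_eigenvectorBasis_adj (m + 2) w j) (eigenvectorBasis_ne_zero _ j)
  have hex : ∀ l v, (adj (m + 2) w).mulVec v = l • v → v ≠ 0 →
      ∃ i, eigenvalue (m + 2) w i = l := by
    intro l v hv h0
    obtain ⟨j, hj⟩ := exists_eigenvalues_eq (adj_isHermitian (m + 2) w) hv h0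
    obtain ⟨i, hi⟩ := exists_eigenvalue_eq m w j
    exact ⟨i, by rw [← hi, hj]⟩
  obtain ⟨i, hi⟩ := hex _ _ hz hz0
  obtain ⟨j, hj⟩ := hex _ _ hy hy0
  have h0 : eigenvalue (m + 2) w 0 = l₁ := by
    have h := hanti.antitone (Fin.zero_le i)
    rcases hmem 0 with h' | h' <;> linarith
  refine ⟨h0, ?_⟩
  have hj0 : j ≠ 0 := by rintro rfl; linarith
  have h1 := hanti.antitone (show (1 : Fin (m + 2)) ≤ j from by
    rw [Fin.le_def]
    have : (j : ℕ) ≠ 0 := fun h => hj0 (Fin.ext h)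
    simp; omega)
  have h01 := hanti (show (0 : Fin (m + 2)) < 1 from by simp)
  rcases hmem 1 with h' | h' <;> linarith

/-- The two chosen terms add up in phase; each remaining term is bounded by the mean of its squared
end entries, and these squares sum to `1` over the whole basis at either end. -/
theorem fidelity_lower_bound {m : ℕ} {w l₁ l₂ : ℝ} {z y : Fin (m + 2) → ℝ}
    (hz : (adj (m + 2) w).mulVec z = l₁ • z) (hy : (adj (m + 2) w).mulVec y = l₂ • y)
    (hz0 : z 0 ≠ 0) (hy0 : y 0 ≠ 0) (hzl : z (Fin.last _) = z 0) (hyl : y (Fin.last _) = -y 0)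
    (hl : l₂ < l₁) (k : ℕ) (t : ℝ) (ht : t * (l₁ - l₂) = (2 * k + 1) * Real.pi) :
    2 * (z 0 ^ 2 / ∑ i, z i ^ 2 + y 0 ^ 2 / ∑ i, y i ^ 2) - 1 ≤
      ‖transition (m + 2) w t 0 (Fin.last _)‖ := by
  have hA := adj_isHermitian (m + 2) w
  have hne : ∀ v : Fin (m + 2) → ℝ, v 0 ≠ 0 → v ≠ 0 := fun v hv h => hv (by simp [h])
  obtain ⟨i, hi⟩ := exists_eigenvalues_eq hA hz (hne z hz0)
  obtain ⟨j, hj⟩ := exists_eigenvalues_eq hA hy (hne y hy0)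
  have hij : i ≠ j := by rintro rfl; linarith
  set b := hA.eigenvectorBasis with hb
  have key : ∀ (v : Fin (m + 2) → ℝ) (i : Fin (m + 2)),
      (adj (m + 2) w).mulVec v = hA.eigenvalues i • v → v 0 ≠ 0 →
      b i 0 ^ 2 = v 0 ^ 2 / ∑ a, v a ^ 2 ∧ v 0 * b i (Fin.last _) = b i 0 * v (Fin.last _) := by
    intro v i hv hv0
    have hp := eigenvector_proportional hv (mulVec_eigenvectorBasis_adj (m + 2) w i)
    refine ⟨?_, hp _⟩
    have hpos : 0 < ∑ a, v a ^ 2 :=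
      lt_of_lt_of_le (by positivity) (Finset.single_le_sum (f := fun a => v a ^ 2)
        (fun a _ => sq_nonneg _) (Finset.mem_univ 0))
    rw [eq_div_iff hpos.ne', Finset.mul_sum, ← mul_one (v 0 ^ 2),
      ← sum_sq_eigenvectorBasis hA i, Finset.mul_sum]
    refine Finset.sum_congr rfl fun a _ => ?_
    have := hp a
    calc b i 0 ^ 2 * v a ^ 2 = (b i 0 * v a) ^ 2 := by ring
      _ = (v 0 * b i a) ^ 2 := by rw [this]
      _ = _ := by ring
  obtain ⟨hzp, hzs⟩ := key z i (by rw [hi, hz]) hz0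
  obtain ⟨hyp, hys⟩ := key y j (by rw [hj, hy]) hy0
  rw [hzl, mul_comm] at hzs
  rw [hyl] at hys
  replace hzs := mul_right_cancel₀ hz0 hzs
  replace hys : b j (Fin.last _) = -b j 0 := mul_left_cancel₀ hy0 (by linear_combination hys)
  rw [← hzp, ← hyp]
  rw [transition, exp_smul_map_apply hA]
  set F : Fin (m + 2) → ℂ := fun a => Complex.exp (Complex.I * t * hA.eigenvalues a) *
        ((b a 0 * b a (Fin.last _) : ℝ) : ℂ) with hF
  change _ ≤ ‖∑ a, F a‖
  have hnorm : ∀ a, ‖F a‖ ≤ (b a 0 ^ 2 + b a (Fin.last _) ^ 2) / 2 := by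
    intro a
    have : Complex.I * t * hA.eigenvalues a = ((t * hA.eigenvalues a : ℝ) : ℂ) * Complex.I := by
      push_cast; ring
    rw [hF, norm_mul, this, Complex.norm_exp_ofReal_mul_I, one_mul, Complex.norm_real,
      Real.norm_eq_abs, abs_le]
    constructor <;> nlinarith [sq_nonneg (b a 0 + b a (Fin.last _)),
      sq_nonneg (b a 0 - b a (Fin.last _))]
  have hexp : Complex.exp (Complex.I * t * l₁) = -Complex.exp (Complex.I * t * l₂) := by
    have : Complex.I * t * l₁ = Complex.I * t * l₂ + (k * (2 * Real.pi * Complex.I) +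
        Real.pi * Complex.I) := by
      have h : ((t * (l₁ - l₂) : ℝ) : ℂ) = (((2 * k + 1) * Real.pi : ℝ) : ℂ) := by rw [ht]
      push_cast at h
      linear_combination Complex.I * h
    rw [this, Complex.exp_add, Complex.exp_add, Complex.exp_nat_mul_two_pi_mul_I,
      Complex.exp_pi_mul_I]
    ring
  have hFij : F i + F j = Complex.exp (Complex.I * t * l₁) * ((b i 0 ^ 2 + b j 0 ^ 2 : ℝ) : ℂ) := by
    simp only [hF, hi, hj, hzs, hys]
    rw [hexp]
    push_cast
    ring
  have hFn : ‖F i + F j‖ = b i 0 ^ 2 + b j 0 ^ 2 := by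
    have : Complex.I * t * l₁ = ((t * l₁ : ℝ) : ℂ) * Complex.I := by push_cast; ring
    rw [hFij, norm_mul, this, Complex.norm_exp_ofReal_mul_I, one_mul, Complex.norm_real,
      Real.norm_of_nonneg (by positivity)]
  have hsplit : ∀ {M : Type} [AddCommMonoid M] (f : Fin (m + 2) → M),
      ∑ a, f a = (f i + f j) + ∑ a ∈ Finset.univ \ {i, j}, f a := by
    intro M _ f
    rw [← Finset.sum_sdiff (Finset.subset_univ {i, j}), Finset.sum_pair hij, add_comm]
  have hrest : ‖∑ a ∈ Finset.univ \ {i, j}, F a‖ ≤ 1 - (b i 0 ^ 2 + b j 0 ^ 2) := by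
    refine (norm_sum_le _ _).trans ((Finset.sum_le_sum fun a _ => hnorm a).trans ?_)
    have h1 := sum_eigenvectorBasis_sq hA 0
    have h2 := sum_eigenvectorBasis_sq hA (Fin.last _)
    rw [hsplit] at h1 h2
    rw [← hb] at h1 h2
    rw [hzs, hys, neg_sq] at h2
    rw [← Finset.sum_div, Finset.sum_add_distrib]
    linarith
  rw [hsplit]
  have := norm_sub_le_norm_add (F i + F j) (∑ a ∈ Finset.univ \ {i, j}, F a)
  linarith

/-! ### Convexity in the eigenvalue and monotonicity of `antiRatio` -/

theorem add_inv_lt_add_inv {x y : ℝ} (hy : 1 < y) (hyx : y < x) : y + y⁻¹ < x + x⁻¹ := by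
  have hx := hy.trans hyx
  have : x + x⁻¹ - (y + y⁻¹) = (x - y) * (x * y - 1) / (x * y) := by field_simp; ring
  have : 0 < (x - y) * (x * y - 1) / (x * y) :=
    div_pos (mul_pos (by linarith) (by nlinarith)) (by positivity)
  linarith

theorem add_inv_le_add_inv {x y : ℝ} (hy : 1 < y) (hyx : y ≤ x) : y + y⁻¹ ≤ x + x⁻¹ := by
  rcases hyx.eq_or_lt with rfl | h
  exacts [le_rfl, (add_inv_lt_add_inv hy h).le]

theorem two_lt_add_inv {x : ℝ} (hx : 1 < x) : 2 < x + x⁻¹ := by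
  have : x + x⁻¹ - 2 = (x - 1) ^ 2 / x := by field_simp; ring
  have : 0 < (x - 1) ^ 2 / x := div_pos (pow_pos (by linarith) 2) (by linarith)
  linarith

/-- `f` is nonnegative, nonincreasing and convex on `(2, ∞)`, with derivative `f'`. -/
structure DecConvex (f f' : ℝ → ℝ) : Prop where
  hasDerivAt : ∀ l, 2 < l → HasDerivAt f (f' l) l
  nonneg : ∀ l, 2 < l → 0 ≤ f l
  nonpos : ∀ l, 2 < l → f' l ≤ 0
  mono : ∀ l l', 2 < l → l ≤ l' → f' l ≤ f' l'

theorem DecConvex.anti {f f' : ℝ → ℝ} (h : DecConvex f f') {l l' : ℝ} (hl : 2 < l) (hll : l ≤ l') :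
    f l' ≤ f l := by
  have : AntitoneOn f (Set.Icc l l') := by
    refine antitoneOn_of_deriv_nonpos (convex_Icc _ _)
      (fun a ha => (h.hasDerivAt a (hl.trans_le ha.1)).continuousAt.continuousWithinAt) ?_ ?_
    · intro a ha
      rw [interior_Icc] at ha
      exact (h.hasDerivAt a (hl.trans ha.1)).differentiableAt.differentiableWithinAt
    · intro a ha
      rw [interior_Icc] at ha
      rw [(h.hasDerivAt a (hl.trans ha.1)).deriv]
      exact h.nonpos a (hl.trans ha.1)
  exact this (Set.left_mem_Icc.2 hll) (Set.right_mem_Icc.2 hll) hll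

theorem DecConvex.mul {f f' g g' : ℝ → ℝ} (hf : DecConvex f f') (hg : DecConvex g g') :
    DecConvex (fun l => f l * g l) (fun l => f' l * g l + f l * g' l) where
  hasDerivAt l hl := (hf.hasDerivAt l hl).mul (hg.hasDerivAt l hl)
  nonneg l hl := mul_nonneg (hf.nonneg l hl) (hg.nonneg l hl)
  nonpos l hl := by
    have h1 := mul_nonneg (neg_nonneg.2 (hf.nonpos l hl)) (hg.nonneg l hl)
    have h2 := mul_nonneg (hf.nonneg l hl) (neg_nonneg.2 (hg.nonpos l hl))
    linarith
  mono l l' hl hll := by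
    have hl' := hl.trans_le hll
    have h1 : -f' l' * g l' ≤ -f' l * g l :=
      mul_le_mul (neg_le_neg (hf.mono l l' hl hll)) (hg.anti hl hll) (hg.nonneg l' hl')
        (neg_nonneg.2 (hf.nonpos l hl))
    have h2 : f l' * -g' l' ≤ f l * -g' l :=
      mul_le_mul (hf.anti hl hll) (neg_le_neg (hg.mono l l' hl hll))
        (neg_nonneg.2 (hg.nonpos l' hl')) (hf.nonneg l hl)
    linarith

theorem DecConvex.inv_sub {f f' : ℝ → ℝ} (hf : DecConvex f f') (h1 : ∀ l, 2 < l → f l ≤ 1) :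
    DecConvex (fun l => (l - f l)⁻¹) (fun l => -(1 - f' l) / (l - f l) ^ 2) where
  hasDerivAt l hl := by
    have := h1 l hl
    exact ((hasDerivAt_id l).sub (hf.hasDerivAt l hl)).inv (by simp only [id, Pi.sub_apply]; linarith)
  nonneg l hl := inv_nonneg.2 (by linarith [h1 l hl])
  nonpos l hl := div_nonpos_of_nonpos_of_nonneg (by linarith [hf.nonpos l hl]) (sq_nonneg _)
  mono l l' hl hll := by
    have := h1 l hl
    have h2 := hf.anti hl hll
    have h3 := hf.mono l l' hl hll
    have h4 := hf.nonpos l' (hl.trans_le hll)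
    rw [neg_div, neg_div, neg_le_neg_iff]
    refine div_le_div₀ (by linarith) (by linarith) (pow_pos (by linarith) 2) ?_
    exact pow_le_pow_left₀ (by linarith) (by linarith) 2

/-- `sinh (k t / 2) / sinh ((k + 2) t / 2)` as a function of `l = 2 cosh t`. -/
noncomputable def sinhRatio : ℕ → ℝ → ℝ
  | 0, _ => 0
  | 1, l => (l - (-1))⁻¹
  | k + 2, l => (l - sinhRatio k l)⁻¹

/-- The addition formula `sinh ((k + 4) t / 2) + sinh (k t / 2) = l * sinh ((k + 2) t / 2)` is the
recursion `f ↦ 1 / (l - f)`, which preserves `DecConvex` as long as `f ≤ 1`. The case `k = 1` fits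
the same pattern, the ratio of index `-1` being `-1`. -/
theorem sinhRatio_decConvex (k : ℕ) :
    (∃ f', DecConvex (sinhRatio k) f') ∧ ∀ l, 2 < l → sinhRatio k l ≤ 1 := by
  have hconst : ∀ c : ℝ, 0 ≤ c → DecConvex (fun _ => c) (fun _ => 0) := fun c hc =>
    ⟨fun l _ => hasDerivAt_const l c, fun _ _ => hc, fun _ _ => le_rfl, fun _ _ _ _ => le_rfl⟩
  induction k using Nat.strong_induction_on with
  | _ k ih =>
    rcases k with _ | _ | k
    · exact ⟨⟨_, hconst 0 le_rfl⟩, fun l _ => by simp [sinhRatio]⟩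
    · refine ⟨⟨fun l => -1 / (l - (-1)) ^ 2, ⟨fun l hl => ?_, fun l hl => ?_, fun l hl => ?_,
        fun l l' hl hll => ?_⟩⟩, fun l hl => ?_⟩
      · exact ((hasDerivAt_id l).sub_const (-1)).inv (by simp only [id]; linarith)
      · exact inv_nonneg.2 (by linarith)
      · exact div_nonpos_of_nonpos_of_nonneg (by norm_num) (sq_nonneg _)
      · rw [neg_div, neg_div, neg_le_neg_iff]
        exact div_le_div_of_nonneg_left zero_le_one (pow_pos (by linarith) 2)
          (pow_le_pow_left₀ (by linarith) (by linarith) 2)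
      · exact inv_le_one_of_one_le₀ (by linarith)
    · obtain ⟨⟨f', hf⟩, h1⟩ := ih k (by omega)
      refine ⟨⟨_, hf.inv_sub h1⟩, fun l hl => ?_⟩
      exact inv_le_one_of_one_le₀ (by linarith [h1 l hl])

/-- `sinh t ^ 2 / (sinh ((m + 3) t / 2) * sinh ((m + 1) t / 2))` as a function of
`l = 2 cosh t`. -/
noncomputable def eigShift : ℕ → ℝ → ℝ
  | 0, l => 1 + sinhRatio 1 l
  | 1, l => sinhRatio 2 l
  | m + 2, l => eigShift m l * (sinhRatio (m + 1) l * sinhRatio (m + 3) l)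

theorem eigShift_decConvex (m : ℕ) : ∃ f', DecConvex (eigShift m) f' := by
  induction m using Nat.strong_induction_on with
  | _ m ih =>
    rcases m with _ | _ | m
    · obtain ⟨⟨f', hf⟩, -⟩ := sinhRatio_decConvex 1
      exact ⟨f', fun l hl => (hf.hasDerivAt l hl).const_add 1,
        fun l hl => add_nonneg zero_le_one (hf.nonneg l hl), hf.nonpos, hf.mono⟩
    · exact (sinhRatio_decConvex 2).1
    · obtain ⟨f', hf⟩ := ih m (by omega)
      obtain ⟨⟨g', hg⟩, -⟩ := sinhRatio_decConvex (m + 1)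
      obtain ⟨⟨h', hh⟩, -⟩ := sinhRatio_decConvex (m + 3)
      exact ⟨_, hf.mul (hg.mul hh)⟩

theorem sinhRatio_add_inv {x : ℝ} (hx : 1 < x) (k : ℕ) :
    sinhRatio k (x + x⁻¹) = x * (x ^ k - 1) / (x ^ (k + 2) - 1) := by
  induction k using Nat.strong_induction_on with
  | _ k ih =>
    have hx0 : x ≠ 0 := by positivity
    rcases k with _ | _ | k
    · simp [sinhRatio]
    · have h3 : x ^ (0 + 1 + 2) - 1 ≠ 0 := (sub_pos.2 (one_lt_pow₀ hx (by omega))).ne'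
      rw [sinhRatio, inv_eq_iff_eq_inv, inv_div, eq_div_iff]
      · field_simp
        ring
      · simp only [zero_add, pow_one]
        exact mul_ne_zero hx0 (sub_pos.2 hx).ne'
    · have h2 : x ^ (k + 2) - 1 ≠ 0 := (sub_pos.2 (one_lt_pow₀ hx (by omega))).ne'
      rw [sinhRatio, ih k (by omega), inv_eq_iff_eq_inv, inv_div, eq_div_iff (mul_ne_zero hx0 h2)]
      field_simp
      ring

theorem eigShift_add_inv {x : ℝ} (hx : 1 < x) (m : ℕ) :
    eigShift m (x + x⁻¹) =
      x ^ (m + 1) * (x ^ 2 - 1) ^ 2 / (x * (x ^ (m + 3) - 1) * (x ^ (m + 1) - 1)) := by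
  have hx0 : x ≠ 0 := by positivity
  have h : ∀ k, x ^ (k + 1) - 1 ≠ 0 := fun k => (sub_pos.2 (one_lt_pow₀ hx (by omega))).ne'
  induction m using Nat.strong_induction_on with
  | _ m ih =>
    rcases m with _ | _ | m
    · have h1 := h 0
      have h3 := h 2
      rw [eigShift, sinhRatio_add_inv hx]
      rw [eq_div_iff (by simp_all), add_mul, div_mul_eq_mul_div, one_mul]
      rw [← eq_sub_iff_add_eq', div_eq_iff (by simpa using h3)]
      ring
    · have h1 := h 1
      have h3 := h 3
      rw [eigShift, sinhRatio_add_inv hx, div_eq_div_iff (by simpa using h3) (by simp [*])]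
      ring
    · have h1 := h m
      have h3 := h (m + 2)
      have h5 := h (m + 4)
      rw [eigShift, ih m (by omega), sinhRatio_add_inv hx, sinhRatio_add_inv hx,
        div_mul_div_comm, div_mul_div_comm, div_eq_div_iff (by simp [*]) (by simp [*])]
      ring

/-- `1 - 1 / w ^ 2` divided by twice the squared first entry of the antisymmetric unit
eigenvector, with `X = x ^ (m + 1)`. -/
noncomputable def antiRatio (m : ℕ) (x : ℝ) : ℝ :=
  (x ^ 2 * (x ^ (m + 1)) ^ 2 - 1) *
    (x ^ 2 * (x ^ (m + 1)) ^ 2 - 1 - (m + 2) * x ^ (m + 1) * (x ^ 2 - 1)) /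
    ((x ^ 2 * x ^ (m + 1) - 1) ^ 2 * (x ^ (m + 1) - 1) ^ 2)

/-- Along the antisymmetric branch `w + 1 / w = l + eigShift m l`, and first-order perturbation of
the two loops gives `dl / dw = 2q`. So `(1 - 1 / w ^ 2) / (2q)` is the derivative of `w + 1 / w` in
`l`. Here the identity is checked by differentiating the closed form in `x`. -/
theorem DecConvex.antiRatio_eq {m : ℕ} {f' : ℝ → ℝ} (hf : DecConvex (eigShift m) f') {x : ℝ}
    (hx : 1 < x) : antiRatio m x = 1 + f' (x + x⁻¹) := by
  have hx0 : x ≠ 0 := by positivity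
  have hlam := two_lt_add_inv hx
  have h1 : x ^ (m + 1) - 1 ≠ 0 := (sub_pos.2 (one_lt_pow₀ hx (by omega))).ne'
  have h3 : x ^ (m + 3) - 1 ≠ 0 := (sub_pos.2 (one_lt_pow₀ hx (by omega))).ne'
  have h2 : x ^ 2 - 1 ≠ 0 := (sub_pos.2 (one_lt_pow₀ hx (by omega))).ne'
  have hcomp : HasDerivAt (fun u : ℝ => eigShift m (u + u⁻¹)) (f' (x + x⁻¹) * (1 + -(x ^ 2)⁻¹)) x :=
    (hf.hasDerivAt _ hlam).comp x ((hasDerivAt_id x).add (hasDerivAt_inv hx0))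
  have hpow : ∀ k : ℕ, HasDerivAt (fun u : ℝ => u ^ (k + 1)) ((k + 1) * x ^ k) x := fun k => by
    simpa using hasDerivAt_pow (k + 1) x
  have hform := ((hpow m).mul (((hasDerivAt_pow 2 x).sub_const 1).pow 2)).div
    (((hasDerivAt_id x).mul ((hpow (m + 2)).sub_const 1)).mul ((hpow m).sub_const 1))
    (by simp [*])
  have heq : (fun u : ℝ => eigShift m (u + u⁻¹)) =ᶠ[nhds x] fun u =>
      u ^ (m + 1) * (u ^ 2 - 1) ^ 2 / (u * (u ^ (m + 3) - 1) * (u ^ (m + 1) - 1)) := by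
    filter_upwards [lt_mem_nhds hx] with u hu using eigShift_add_inv hu m
  have hder := (hcomp.congr_of_eventuallyEq heq.symm).unique hform
  simp only [Pi.mul_apply, Pi.pow_apply, id] at hder
  have hX : x ^ m = x ^ (m + 1) / x := by field_simp; ring
  have hX2 : x ^ (m + 2) = x ^ (m + 1) * x := by ring
  have hX3 : x ^ (m + 3) = x ^ 2 * x ^ (m + 1) := by ring
  rw [hX3] at h3 hder
  rw [hX2, hX] at hder
  rw [antiRatio]
  set X := x ^ (m + 1)
  have hfac : (1 + -(x ^ 2)⁻¹ : ℝ) ≠ 0 := by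
    have : (1 + -(x ^ 2)⁻¹ : ℝ) = (x ^ 2 - 1) / x ^ 2 := by field_simp; ring
    rw [this]; positivity
  refine mul_right_cancel₀ hfac ?_
  rw [add_mul 1, hder]
  push_cast
  field_simp
  ring

theorem antiRatio_mono (m : ℕ) {x y : ℝ} (hy : 1 < y) (hyx : y ≤ x) :
    antiRatio m y ≤ antiRatio m x := by
  obtain ⟨f', hf⟩ := eigShift_decConvex m
  have hx := hy.trans_le hyx
  have hy0 : y ≠ 0 := by positivity
  rw [hf.antiRatio_eq hy, hf.antiRatio_eq hx]
  have hlam := two_lt_add_inv hy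
  linarith [hf.mono _ _ hlam (add_inv_le_add_inv hy hyx)]

/-! ### Comparison of the two ratios at a common point -/

/-- With `X = exp (2 t)` this is `tanh ((m + 2) t) / (m + 2) ≤ tanh (2 t) / 2`, an instance of `tanh
s / s` being decreasing. -/
theorem coth_comparison {X : ℝ} (hX : 1 ≤ X) (m : ℕ) :
    2 * (X ^ (m + 2) - 1) * (X ^ 2 + 1) ≤ (m + 2) * (X ^ (m + 2) + 1) * (X ^ 2 - 1) := by
  induction m with
  | zero => norm_num; nlinarith
  | succ m ih =>
    have hb : 1 + ((m + 2 : ℕ) : ℝ) * (X - 1) ≤ X ^ (m + 2) := by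
      have := one_add_mul_le_pow (a := X - 1) (by linarith) (m + 2)
      simpa using this
    push_cast at hb ⊢
    -- The difference of the two sides at `m + 1` is exactly the sum of the quantities in `h1`
    -- (induction), `h2` (Bernoulli) and `h3`.
    have h1 : 0 ≤ X * ((m + 2) * (X ^ (m + 2) + 1) * (X ^ 2 - 1) -
      2 * (X ^ (m + 2) - 1) * (X ^ 2 + 1)) := mul_nonneg (by linarith) (by linarith)
    have h2 : 0 ≤ (X - 1) * (X * (X + 1)) * (X ^ (m + 2) - (1 + (m + 2) * (X - 1))) :=
      mul_nonneg (mul_nonneg (by linarith) (by nlinarith)) (by linarith)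
    have h3 : 0 ≤ (X - 1) * ((X - 1) ^ 2 * ((m + 2) * X + (m + 1))) := by
      have : (0 : ℝ) ≤ m := m.cast_nonneg
      exact mul_nonneg (by linarith) (mul_nonneg (sq_nonneg _) (by nlinarith))
    have e : X ^ (m + 1 + 2) = X * X ^ (m + 2) := by ring
    rw [e]
    nlinarith [h1, h2, h3]

/-- `1 - 1 / w ^ 2` divided by twice the squared first entry of the symmetric unit
eigenvector, with `X = x ^ (m + 1)`. -/
noncomputable def symRatio (m : ℕ) (x : ℝ) : ℝ :=
  (x ^ 2 * (x ^ (m + 1)) ^ 2 - 1) *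
    (x ^ 2 * (x ^ (m + 1)) ^ 2 - 1 + (m + 2) * x ^ (m + 1) * (x ^ 2 - 1)) /
    ((x ^ 2 * x ^ (m + 1) + 1) ^ 2 * (x ^ (m + 1) + 1) ^ 2)

theorem symRatio_add_antiRatio_le (m : ℕ) {x : ℝ} (hx : 1 < x) :
    symRatio m x + antiRatio m x ≤ 2 := by
  have h1 : 0 < x ^ (m + 1) - 1 := sub_pos.2 (one_lt_pow₀ hx (by omega))
  have hX2 : 1 < x ^ 2 := one_lt_pow₀ hx (by omega)
  have hc := coth_comparison hX2.le m
  have e : (x ^ 2) ^ (m + 2) = x ^ 2 * (x ^ (m + 1)) ^ 2 := by ring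
  rw [e] at hc
  rw [symRatio, antiRatio]
  set X := x ^ (m + 1)
  have h3 : 0 < x ^ 2 * X - 1 := by nlinarith
  rw [div_add_div _ _ (by positivity) (by positivity), div_le_iff₀ (by positivity), ← sub_nonneg]
  have h2 : 0 ≤ (x ^ 2 * X ^ 2 - 1) * ((m + 2) * (x ^ 2 * X ^ 2 + 1) * ((x ^ 2) ^ 2 - 1) -
      2 * (x ^ 2 * X ^ 2 - 1) * ((x ^ 2) ^ 2 + 1)) := mul_nonneg (by nlinarith) (by linarith)
  -- This expression is the right side minus the left after clearing denominators.
  have h4 : 0 ≤ 4 * X ^ 2 * ((x ^ 2 * X ^ 2 - 1) * ((m + 2) * (x ^ 2 * X ^ 2 + 1) *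
      ((x ^ 2) ^ 2 - 1) - 2 * (x ^ 2 * X ^ 2 - 1) * ((x ^ 2) ^ 2 + 1))) +
      2 * X ^ 2 * (x ^ 2 - 1) ^ 2 * ((x ^ 2 * X ^ 2 - 1) ^ 2 + X ^ 2 * (x ^ 2 - 1) ^ 2) := by
    positivity
  refine h4.trans_eq ?_
  ring
-- Explicit eigenvectors and their weight at the ends
/-- `x` parametrizes an eigenvalue `x + x⁻¹` of `adj (m + 2) w` whose eigenvector is symmetric
(`ε = 1`) or antisymmetric (`ε = -1`). -/
def IsRoot (m : ℕ) (w ε x : ℝ) : Prop := x ^ (m + 3) + ε = w * (x ^ (m + 2) + ε * x)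

/-- The (anti)symmetric sequence `x ^ (m + 1 - j) + ε * x ^ j`. -/
def rootSeq (m : ℕ) (ε x : ℝ) (j : ℕ) : ℝ := x ^ (m + 1 - j) + ε * x ^ j

theorem IsRoot.isEigenseq {m : ℕ} {w ε x : ℝ} (h : IsRoot m w ε x) (hx : x ≠ 0)
    (hε : ε ^ 2 = 1) : IsEigenseq m w (x + x⁻¹) (rootSeq m ε x) := by
  have hx1 : x * x⁻¹ = 1 := mul_inv_cancel₀ hx
  have h' : w * (x ^ (m + 1) + ε) = x ^ (m + 2) + ε * x⁻¹ := by
    rw [IsRoot] at h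
    apply mul_left_cancel₀ hx
    linear_combination -h - ε * hx1
  refine ⟨?_, fun i hi => ?_, ?_⟩
  · simp only [rootSeq, Nat.add_sub_cancel, Nat.sub_zero, pow_zero, pow_one]
    linear_combination h' - x ^ m * hx1
  · obtain ⟨k, rfl⟩ := Nat.exists_eq_add_of_lt hi
    simp only [rootSeq]
    rw [show i + k + 1 + 1 - i = k + 2 by omega, show i + k + 1 + 1 - (i + 2) = k by omega,
      show i + k + 1 + 1 - (i + 1) = k + 1 by omega]
    linear_combination -(x ^ k + ε * x ^ i) * hx1
  · simp only [rootSeq]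
    rw [show m + 1 - m = 1 by omega, Nat.sub_self]
    linear_combination ε * h' - (w - x⁻¹) * hε - ε * x ^ m * hx1

theorem sum_rootSeq_sq (m : ℕ) {ε x : ℝ} (hε : ε ^ 2 = 1) :
    (x ^ 2 - 1) * ∑ i : Fin (m + 2), rootSeq m ε x i ^ 2 =
      2 * (x ^ 2 * (x ^ (m + 1)) ^ 2 - 1 + ε * ((m + 2) * x ^ (m + 1) * (x ^ 2 - 1))) := by
  have h1 : ∀ j ∈ Finset.range (m + 2), rootSeq m ε x j ^ 2 =
      (x ^ 2) ^ (m + 2 - 1 - j) + (x ^ 2) ^ j + 2 * ε * x ^ (m + 1) := by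
    intro j hj
    obtain ⟨k, hk⟩ := Nat.exists_eq_add_of_le (Nat.lt_succ_iff.1 (Finset.mem_range.1 hj))
    rw [rootSeq, hk, show m + 2 - 1 - j = k by omega, show j + k - j = k by omega]
    linear_combination (x ^ j) ^ 2 * hε
  have hg := mul_geom_sum (x ^ 2) (m + 2)
  rw [Fin.sum_univ_eq_sum_range (fun j => rootSeq m ε x j ^ 2), Finset.sum_congr rfl h1,
    Finset.sum_add_distrib, Finset.sum_add_distrib,
    Finset.sum_range_reflect (fun j => (x ^ 2) ^ j) (m + 2), Finset.sum_const, Finset.card_range,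
    nsmul_eq_mul]
  push_cast
  linear_combination 2 * hg

theorem IsRoot.ratio_eq {m : ℕ} {w ε x : ℝ} (h : IsRoot m w ε x) (hx : 1 < x)
    (hε : ε = 1 ∨ ε = -1) :
    (1 - 1 / w ^ 2) / (2 * (rootSeq m ε x 0 ^ 2 / ∑ i : Fin (m + 2), rootSeq m ε x i ^ 2)) =
      (x ^ 2 * (x ^ (m + 1)) ^ 2 - 1) *
        (x ^ 2 * (x ^ (m + 1)) ^ 2 - 1 + ε * ((m + 2) * x ^ (m + 1) * (x ^ 2 - 1))) /
        ((x ^ 2 * x ^ (m + 1) + ε) ^ 2 * (x ^ (m + 1) + ε) ^ 2) := by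
  have hε2 : ε ^ 2 = 1 := by rcases hε with rfl | rfl <;> norm_num
  have hsum := sum_rootSeq_sq m (x := x) hε2
  have hX : 1 < x ^ (m + 1) := one_lt_pow₀ hx (by omega)
  have hx2 : 0 < x ^ 2 - 1 := sub_pos.2 (one_lt_pow₀ hx (by omega))
  have hroot : w * (x * (x ^ (m + 1) + ε)) = x ^ 2 * x ^ (m + 1) + ε := by
    rw [IsRoot] at h
    linear_combination -h
  have h0 : rootSeq m ε x 0 = x ^ (m + 1) + ε := by simp [rootSeq]
  rw [h0]
  set X := x ^ (m + 1)
  have hXε : X + ε ≠ 0 := by rcases hε with rfl | rfl <;> linarith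
  have hXε2 : x ^ 2 * X + ε ≠ 0 := by rcases hε with rfl | rfl <;> nlinarith
  have hx0 : x ≠ 0 := by positivity
  have hw : w = (x ^ 2 * X + ε) / (x * (X + ε)) := by
    rw [eq_div_iff (mul_ne_zero hx0 hXε), hroot]
  have hS : ∑ i : Fin (m + 2), rootSeq m ε x i ^ 2 =
      2 * (x ^ 2 * X ^ 2 - 1 + ε * ((m + 2) * X * (x ^ 2 - 1))) / (x ^ 2 - 1) := by
    rw [eq_div_iff hx2.ne', ← hsum]; ring
  have hκ : 1 - 1 / w ^ 2 = (x ^ 2 * X ^ 2 - 1) * (x ^ 2 - 1) / (x ^ 2 * X + ε) ^ 2 := by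
    rw [hw]
    field_simp
    linear_combination (1 - x ^ 2) * hε2
  rw [hκ, hS]
  have := hx2.ne'
  field_simp

theorem rootSeq_zero_ne {m : ℕ} {ε x : ℝ} (hx : 1 < x) (hε : ε = 1 ∨ ε = -1) :
    rootSeq m ε x 0 ≠ 0 := by
  have hX : 1 < x ^ (m + 1) := one_lt_pow₀ hx (by omega)
  have h0 : rootSeq m ε x 0 = x ^ (m + 1) + ε := by simp [rootSeq]
  rw [h0]
  rcases hε with rfl | rfl <;> linarith

theorem one_sub_le_sum_of_isRoot {m : ℕ} {w x y : ℝ} (hw : 1 < w) (hx : IsRoot m w 1 x)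
    (hy : IsRoot m w (-1) y) (hy1 : 1 < y) (hyx : y ≤ x) :
    1 - 1 / w ^ 2 ≤ rootSeq m 1 x 0 ^ 2 / ∑ i : Fin (m + 2), rootSeq m 1 x i ^ 2 +
      rootSeq m (-1) y 0 ^ 2 / ∑ i : Fin (m + 2), rootSeq m (-1) y i ^ 2 := by
  have hx1 := hy1.trans_le hyx
  have h1 := hx.ratio_eq hx1 (Or.inl rfl)
  have h2 := hy.ratio_eq hy1 (Or.inr rfl)
  have h3 := symRatio_add_antiRatio_le m hx1
  have h4 := antiRatio_mono m hy1 hyx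
  have e1 : symRatio m x = (1 - 1 / w ^ 2) /
      (2 * (rootSeq m 1 x 0 ^ 2 / ∑ i : Fin (m + 2), rootSeq m 1 x i ^ 2)) := by
    rw [h1, symRatio, one_mul]
  have e2 : antiRatio m y = (1 - 1 / w ^ 2) /
      (2 * (rootSeq m (-1) y 0 ^ 2 / ∑ i : Fin (m + 2), rootSeq m (-1) y i ^ 2)) := by
    rw [h2, antiRatio, neg_one_mul, ← sub_eq_add_neg, ← sub_eq_add_neg, ← sub_eq_add_neg]
  have hpos : ∀ ε u : ℝ, rootSeq m ε u 0 ≠ 0 →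
      0 < rootSeq m ε u 0 ^ 2 / ∑ i : Fin (m + 2), rootSeq m ε u i ^ 2 := by
    intro ε u h0
    refine div_pos (by positivity) (lt_of_lt_of_le (b := rootSeq m ε u 0 ^ 2) (by positivity) ?_)
    exact Finset.single_le_sum (f := fun i : Fin (m + 2) => rootSeq m ε u i ^ 2)
      (fun a _ => sq_nonneg _) (Finset.mem_univ 0)
  have hp := hpos 1 x (rootSeq_zero_ne hx1 (Or.inl rfl))
  have hq := hpos (-1) y (rootSeq_zero_ne hy1 (Or.inr rfl))
  have hκ : 0 < 1 - 1 / w ^ 2 := by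
    rw [sub_pos, div_lt_one (by positivity)]
    exact one_lt_pow₀ hw (by norm_num)
  rw [e1] at h3
  rw [e2] at h4
  set p := rootSeq m 1 x 0 ^ 2 / ∑ i : Fin (m + 2), rootSeq m 1 x i ^ 2
  set q := rootSeq m (-1) y 0 ^ 2 / ∑ i : Fin (m + 2), rootSeq m (-1) y i ^ 2
  set c := 1 - 1 / w ^ 2
  have h5 : c / (2 * p) + c / (2 * q) ≤ 2 := by linarith
  rw [div_add_div _ _ (by positivity) (by positivity), div_le_iff₀ (by positivity)] at h5
  -- `h5` amounts to `c (p + q) ≤ 4 p q`, and `4 p q ≤ (p + q) ^ 2`.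
  nlinarith [sq_nonneg (p - q)]

/-! ### Location and existence of the roots -/

theorem IsRoot.factor {m : ℕ} {w u : ℝ} {ε : ℝ} (h : IsRoot m w ε u) :
    u ^ (m + 2) * (u - w) = ε * (w * u - 1) := by
  rw [IsRoot] at h
  linear_combination h

theorem IsRoot.lt_of_one {m : ℕ} {w u : ℝ} (h : IsRoot m w 1 u) (hw : 1 < w) (hu : 1 < u) :
    w < u := by
  have h' := h.factor
  have : 0 < u ^ (m + 2) * (u - w) := by rw [h']; nlinarith
  linarith [(mul_pos_iff_of_pos_left (by positivity)).1 this]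

theorem IsRoot.lt_of_neg_one {m : ℕ} {w u : ℝ} (h : IsRoot m w (-1) u) (hw : 1 < w)
    (hu : 1 < u) : u < w := by
  have h' := h.factor
  have : 0 < u ^ (m + 2) * (w - u) := by nlinarith
  linarith [(mul_pos_iff_of_pos_left (by positivity)).1 this]

/-- Symmetric roots solve `u ^ (m + 2) = (w u - 1) / (u - w)` on `u > w`, where the left side
increases and the right side decreases. Used both ways, this gives uniqueness. -/
theorem IsRoot.not_lt {m : ℕ} {w u x : ℝ} (h : IsRoot m w 1 u) (h' : IsRoot m w 1 x) (hw : 1 < w)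
    (hu : 1 < u) : ¬ u < x := by
  intro hux
  have hwu := h.lt_of_one hw hu
  have e1 := h.factor
  have e2 := h'.factor
  have hpow : u ^ (m + 2) ≤ x ^ (m + 2) := pow_le_pow_left₀ (by linarith) hux.le _
  have hup : 0 < u ^ (m + 2) := by positivity
  have h1 : 0 < w * u - 1 := by nlinarith
  have h2 : u ^ (m + 2) * ((u - w) * (w * x - 1)) < u ^ (m + 2) * ((x - w) * (w * u - 1)) := by
    refine mul_lt_mul_of_pos_left ?_ hup
    nlinarith [mul_pos (sub_pos.2 hux) (show 0 < w ^ 2 - 1 by nlinarith)]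
  have h3 : u ^ (m + 2) * ((x - w) * (w * u - 1)) ≤ x ^ (m + 2) * ((x - w) * (w * u - 1)) :=
    mul_le_mul_of_nonneg_right hpow (mul_nonneg (by linarith) h1.le)
  have h4 : u ^ (m + 2) * ((u - w) * (w * x - 1)) = (w * u - 1) * (w * x - 1) := by
    linear_combination (w * x - 1) * e1
  have h5 : x ^ (m + 2) * ((x - w) * (w * u - 1)) = (w * u - 1) * (w * x - 1) := by
    linear_combination (w * u - 1) * e2
  linarith

theorem IsEigenseq.exists_isRoot {m : ℕ} {w μ : ℝ} {V : ℕ → ℝ}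
    (hV : IsEigenseq m w μ V) (h0 : V 0 ≠ 0) (hμ : 2 < μ) :
    ∃ u, 1 < u ∧ μ = u + u⁻¹ ∧ (IsRoot m w 1 u ∨ IsRoot m w (-1) u) := by
  have hd : 0 < μ ^ 2 - 4 := by nlinarith
  obtain ⟨u, hu1, hμu⟩ : ∃ u : ℝ, 1 < u ∧ μ = u + u⁻¹ := by
    have hs := Real.sq_sqrt hd.le
    have hsp := Real.sqrt_nonneg (μ ^ 2 - 4)
    refine ⟨(μ + √(μ ^ 2 - 4)) / 2, by linarith, ?_⟩
    rw [eq_comm, ← sub_eq_zero]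
    have : (μ + √(μ ^ 2 - 4)) ≠ 0 := by positivity
    field_simp
    linear_combination hs
  refine ⟨u, hu1, hμu, ?_⟩
  have hu0 : u ≠ 0 := by positivity
  have hinv : u * u⁻¹ = 1 := mul_inv_cancel₀ hu0
  obtain ⟨hf, hm, hl⟩ := hV
  rw [hμu] at hf hm hl
  -- The two combinations in `hp` and `hq` diagonalise the recurrence: they are geometric with
  -- ratios `u` and `u⁻¹`. The last row then links `V 0` and `V (m + 1)` in two ways, and
  -- eliminating `V (m + 1)` leaves the equality of squares `hsq`.
  have hp : ∀ j ≤ m, V (j + 1) - u⁻¹ * V j = u ^ j * ((u - w) * V 0) := by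
    intro j
    induction j with
    | zero => intro _; linear_combination hf
    | succ j ih =>
      intro hj
      linear_combination hm j (by omega) + u * ih (by omega) + V j * hinv
  have hq : ∀ j ≤ m, u ^ j * (V (j + 1) - u * V j) = (u⁻¹ - w) * V 0 := by
    intro j
    induction j with
    | zero => intro _; linear_combination hf
    | succ j ih =>
      intro hj
      linear_combination u ^ (j + 1) * hm j (by omega) + ih (by omega)
        + u ^ j * V (j + 1) * hinv
  have e1 : u ^ (m + 2) * (u - w) * V 0 = V (m + 1) * (w * u - 1) := by
    linear_combination -u ^ 2 * hp m le_rfl - u ^ 2 * u⁻¹ * hl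
      + (u * (w - u - u⁻¹) - 1) * V (m + 1) * hinv
  have e2 : (w * u - 1) * V 0 = V (m + 1) * (u ^ (m + 2) * (u - w)) := by
    linear_combination u * hq m le_rfl + u ^ (m + 2) * hl + (V 0 + u ^ (m + 1) * V (m + 1)) * hinv
  have hsq : (u ^ (m + 2) * (u - w)) ^ 2 = (w * u - 1) ^ 2 := by
    apply mul_right_cancel₀ h0
    linear_combination u ^ (m + 2) * (u - w) * e1 - (w * u - 1) * e2
  rcases sq_eq_sq_iff_eq_or_eq_neg.1 hsq with h | h
  · left; rw [IsRoot]; linear_combination h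
  · right; rw [IsRoot]; linear_combination h

theorem exists_isRoot_one (m : ℕ) {w : ℝ} (hw : 1 < w) : ∃ x, 1 < x ∧ IsRoot m w 1 x := by
  have hc : ContinuousOn (fun x : ℝ => x ^ (m + 3) + 1 - w * (x ^ (m + 2) + 1 * x))
      (Set.Icc w (w + 1)) := by fun_prop
  have hsq : (w + 1) ^ 2 ≤ (w + 1) ^ (m + 2) := pow_le_pow_right₀ (by linarith) (by omega)
  obtain ⟨x, hx, h⟩ := intermediate_value_Icc (by linarith) hc
    (show (0 : ℝ) ∈ Set.Icc _ _ from ⟨by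
      have : w ^ (m + 3) + 1 - w * (w ^ (m + 2) + 1 * w) = 1 - w ^ 2 := by ring
      simp only [this]; nlinarith, by
      have : (w + 1) ^ (m + 3) + 1 - w * ((w + 1) ^ (m + 2) + 1 * (w + 1)) =
        (w + 1) ^ (m + 2) + 1 - w * (w + 1) := by ring
      simp only [this]; nlinarith⟩)
  exact ⟨x, by linarith [hx.1], by rw [IsRoot]; linarith⟩

/-- The antisymmetric equation always has the spurious root `1`. Once it is divided out, the
quotient `f` has `f 1 = m + 3 - w (m + 1) < 0` and `f w = w + 1`, so genuine roots exist; they lie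
below `w`, and compactness yields the greatest. -/
theorem exists_greatest_isRoot_neg_one {m : ℕ} {w : ℝ} (hw : 1 < w) (h : m + 3 < w * (m + 1)) :
    ∃ y, 1 < y ∧ IsRoot m w (-1) y ∧ ∀ u, 1 < u → IsRoot m w (-1) u → u ≤ y := by
  set f : ℝ → ℝ := fun y => ∑ k ∈ Finset.range (m + 3), y ^ k -
    w * (y * ∑ k ∈ Finset.range (m + 1), y ^ k) with hf
  have hfc : Continuous f := by fun_prop
  have hfm : ∀ y, (y - 1) * f y = y ^ (m + 3) + -1 - w * (y ^ (m + 2) + -1 * y) := by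
    intro y
    have h1 := mul_geom_sum y (m + 3)
    have h2 := mul_geom_sum y (m + 1)
    simp only [hf]
    linear_combination h1 - w * y * h2
  have hf1 : f 1 < 0 := by
    simp only [hf, one_pow, Finset.sum_const, Finset.card_range, nsmul_eq_mul]
    push_cast
    linarith
  have hfw : 0 ≤ f w := by
    have : (w - 1) * f w = (w - 1) * (w + 1) := by rw [hfm]; ring
    have := mul_left_cancel₀ (sub_pos.2 hw).ne' this
    linarith
  have hroot : ∀ u, 1 < u → (IsRoot m w (-1) u ↔ f u = 0) := by
    intro u hu
    rw [IsRoot, ← sub_eq_zero, ← hfm, mul_eq_zero, or_iff_right (sub_pos.2 hu).ne']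
  have hcomp : IsCompact (Set.Icc 1 w ∩ f ⁻¹' {0}) :=
    isCompact_Icc.inter_right (isClosed_singleton.preimage hfc)
  obtain ⟨y₀, hy₀, hfy₀⟩ := intermediate_value_Icc hw.le hfc.continuousOn
    (show (0 : ℝ) ∈ Set.Icc _ _ from ⟨hf1.le, hfw⟩)
  obtain ⟨y, ⟨hy, hfy⟩, hmax⟩ := hcomp.exists_isGreatest ⟨y₀, hy₀, hfy₀⟩
  have hy1 : 1 < y := lt_of_le_of_ne hy.1 (by rintro rfl; exact hf1.ne hfy)
  exact ⟨y, hy1, (hroot y hy1).2 hfy, fun u hu hr =>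
    hmax ⟨⟨hu.le, (hr.lt_of_neg_one hw hu).le⟩, (hroot u hu).1 hr⟩⟩

/-! ### The top two eigenpairs -/

/-- The top two eigenpairs of `adj (m + 2) w`, the first symmetric and the second antisymmetric,
with the weight that their unit eigenvectors carry at an end vertex bounded from below. -/
def HasTopPair (m : ℕ) (w : ℝ) : Prop :=
  ∃ (l₁ l₂ : ℝ) (z y : Fin (m + 2) → ℝ), (adj (m + 2) w).mulVec z = l₁ • z ∧
    (adj (m + 2) w).mulVec y = l₂ • y ∧ z 0 ≠ 0 ∧ y 0 ≠ 0 ∧ z (Fin.last _) = z 0 ∧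
    y (Fin.last _) = -y 0 ∧ l₂ < l₁ ∧
    (∀ μ v, (adj (m + 2) w).mulVec v = μ • v → v ≠ 0 → μ = l₁ ∨ μ ≤ l₂) ∧
    1 - 1 / w ^ 2 ≤ z 0 ^ 2 / ∑ i, z i ^ 2 + y 0 ^ 2 / ∑ i, y i ^ 2

theorem hasTopPair_of_lt {m : ℕ} {w : ℝ} (hw : 1 < w) (h : m + 3 < w * (m + 1)) :
    HasTopPair m w := by
  obtain ⟨x, hx1, hx⟩ := exists_isRoot_one m hw
  obtain ⟨y, hy1, hy, hmax⟩ := exists_greatest_isRoot_neg_one hw h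
  have hyx : y < x := (hy.lt_of_neg_one hw hy1).trans (hx.lt_of_one hw hx1)
  have hl := add_inv_lt_add_inv hy1 hyx
  refine ⟨x + x⁻¹, y + y⁻¹, fun i => rootSeq m 1 x i, fun i => rootSeq m (-1) y i,
    (adj_mulVec_eq_smul_iff _ _ _ _).2 (hx.isEigenseq (by positivity) (by norm_num)),
    (adj_mulVec_eq_smul_iff _ _ _ _).2 (hy.isEigenseq (by positivity) (by norm_num)),
    rootSeq_zero_ne hx1 (Or.inl rfl), rootSeq_zero_ne hy1 (Or.inr rfl), ?_, ?_, hl, ?_,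
    one_sub_le_sum_of_isRoot hw hx hy hy1 hyx.le⟩
  · simp [rootSeq, add_comm]
  · simp [rootSeq]
  · intro μ v hv hv0
    rcases le_or_gt μ 2 with hμ | hμ
    · exact Or.inr (hμ.trans (two_lt_add_inv hy1).le)
    have h0 : extend v 0 ≠ 0 := by simpa [extend] using eigenvector_zero_ne hv hv0
    obtain ⟨u, hu1, rfl, hu | hu⟩ := (isEigenseq_extend hv).exists_isRoot h0 hμ
    · left
      rw [le_antisymm (not_lt.1 (hx.not_lt hu hw hx1)) (not_lt.1 (hu.not_lt hx hw hu1))]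
    · exact Or.inr (add_inv_le_add_inv hu1 (hmax u hu1 hu))

/-- For `n = 2` and `n = 3` the second eigenvalue, `w - 1` or `w`, may be at most `2`, so a
parameter `y > 1` need not exist. -/
theorem hasTopPair_zero {w : ℝ} : HasTopPair 0 w := by
  refine ⟨w + 1, w - 1, fun i => (fun _ => 1 : ℕ → ℝ) i, fun i => (fun j => 1 - 2 * j : ℕ → ℝ) i,
    (adj_mulVec_eq_smul_iff _ _ _ (fun _ => 1)).2 ⟨by ring, by simp, by ring⟩,
    (adj_mulVec_eq_smul_iff _ _ _ (fun j => 1 - 2 * j)).2 ⟨by norm_num; ring, by simp, by norm_num; ring⟩,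
    by simp, by simp, by simp, by norm_num, by linarith, ?_, ?_⟩
  · intro μ v hv hv0
    have h0 : extend v 0 ≠ 0 := by simpa [extend] using eigenvector_zero_ne hv hv0
    obtain ⟨h1, -, h2⟩ := isEigenseq_extend hv
    have : (μ - (w + 1)) * (μ - (w - 1)) = 0 := by
      apply mul_right_cancel₀ h0
      simp only [zero_add] at h1 h2
      linear_combination (-(μ - w)) * h1 - h2
    rcases mul_eq_zero.1 this with h | h
    · left; linarith
    · right; linarith
  · have : 0 ≤ 1 / w ^ 2 := by positivity
    norm_num [Fin.sum_univ_succ]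
    positivity

theorem hasTopPair_one {w : ℝ} (hw : 1 < w) : HasTopPair 1 w := by
  -- This equation makes `(1, d, 1)` an eigenvector with eigenvalue `w + d`; the third eigenvalue is
  -- `-d`.
  obtain ⟨d, hd, hdw⟩ : ∃ d : ℝ, 0 < d ∧ d ^ 2 + w * d = 2 := by
    have hs := Real.sq_sqrt (show 0 ≤ w ^ 2 + 8 by positivity)
    refine ⟨(√(w ^ 2 + 8) - w) / 2, ?_, by linear_combination hs / 4⟩
    have := Real.lt_sqrt_of_sq_lt (show w ^ 2 < w ^ 2 + 8 by linarith)
    linarith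
  refine ⟨w + d, w, fun i => (fun j => if j = 1 then d else 1 : ℕ → ℝ) i,
    fun i => (fun j => 1 - j : ℕ → ℝ) i,
    (adj_mulVec_eq_smul_iff _ _ _ (fun j => if j = 1 then d else 1)).2 ⟨by simp, fun i hi => ?_, by simp; ring⟩,
    (adj_mulVec_eq_smul_iff _ _ _ (fun j => 1 - j)).2 ⟨by simp, fun i hi => ?_, by norm_num⟩,
    by simp, by simp, by simp, by norm_num, by linarith, ?_, ?_⟩
  · obtain rfl : i = 0 := by omega
    simp; linear_combination -hdw
  · obtain rfl : i = 0 := by omega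
    norm_num
  · intro μ v hv hv0
    have h0 : extend v 0 ≠ 0 := by simpa [extend] using eigenvector_zero_ne hv hv0
    obtain ⟨h1, h2, h3⟩ := isEigenseq_extend hv
    have h2' := h2 0 (by omega)
    simp only [zero_add] at h1 h2' h3
    have : (μ - w) * ((μ - (w + d)) * (μ + d)) = 0 := by
      apply mul_right_cancel₀ h0
      norm_num at h3
      linear_combination (-(μ - w) * μ + 1) * h1 - (μ - w) * h2' - h3 - (μ - w) * extend v 0 * hdw
    rcases mul_eq_zero.1 this with h | h
    · right; linarith
    rcases mul_eq_zero.1 h with h | h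
    · left; linarith
    · right; linarith
  · norm_num [Fin.sum_univ_succ]
    have h1 : w * d < 2 := by nlinarith
    rw [show (1 : ℝ) + (d ^ 2 + 1) = 2 + d ^ 2 by ring]
    have h2 : 1 / 2 - (w ^ 2)⁻¹ ≤ (2 + d ^ 2)⁻¹ := by
      rw [inv_eq_one_div, inv_eq_one_div, div_sub_div _ _ (by norm_num) (by positivity),
        div_le_div_iff₀ (by positivity) (by positivity)]
      nlinarith [mul_pos hd hd, mul_pos (show 0 < w by linarith) hd]
    linarith

/-- From `n = 6` on, `w ≥ √2` suffices; the bound on `tau` is needed for `n = 4` (to get `w > 5 /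
3`) and `n = 5` (to get `w > 3 / 2`). -/
theorem lt_of_tau {m : ℕ} {w : ℝ} (hw : √2 ≤ w) (hτ : 2 ≤ w + 1 / w - tau (m + 4) w) :
    ((m + 2 : ℕ) : ℝ) + 3 < w * ((m + 2 : ℕ) + 1) := by
  -- The case `n = 6` requires `w > 7 / 5`.
  have hw1 : 1.41 < w := lt_of_lt_of_le (Real.lt_sqrt_of_sq_lt (by norm_num)) hw
  have hw0 : 0 < w := by linarith
  push_cast
  have key : ∀ c : ℕ, 0 < c → 2 ≤ w + 1 / w - (w + 1) ^ 2 * (w - 1) / (w * (w ^ (2 * c) - 1)) →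
      (w + 1) ^ 2 ≤ (w - 1) * (w ^ (2 * c) - 1) := by
    intro c hc h
    have hp : 0 < w ^ (2 * c) - 1 := sub_pos.2 (one_lt_pow₀ (by linarith) (by omega))
    have h1 : (w + 1) ^ 2 * (w - 1) / (w * (w ^ (2 * c) - 1)) ≤ (w - 1) ^ 2 / w := by
      have : w + 1 / w - 2 = (w - 1) ^ 2 / w := by field_simp; ring
      linarith
    rw [div_le_div_iff₀ (by positivity) hw0] at h1
    have h2 : (w * (w - 1)) * (w + 1) ^ 2 ≤ (w * (w - 1)) * ((w - 1) * (w ^ (2 * c) - 1)) := by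
      linarith
    exact le_of_mul_le_mul_left h2 (mul_pos hw0 (by linarith))
  rcases m with _ | _ | m
  · by_contra hcon
    have hw5 : w ≤ 5 / 3 := by norm_num at hcon; linarith
    have hceil : ⌈((0 + 4 : ℕ) : ℝ) / 2⌉₊ = 2 := by
      rw [Nat.ceil_eq_iff (by norm_num)]; norm_num
    rw [tau, hceil] at hτ
    have h := key 2 (by norm_num) hτ
    have h4 : w ^ (2 * 2) ≤ (5 / 3) ^ (2 * 2) := pow_le_pow_left₀ hw0.le hw5 _
    norm_num at h h4
    nlinarith
  · by_contra hcon
    have hw5 : w ≤ 3 / 2 := by norm_num at hcon; linarith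
    have hceil : ⌈((0 + 1 + 4 : ℕ) : ℝ) / 2⌉₊ = 3 := by
      rw [Nat.ceil_eq_iff (by norm_num)]; norm_num
    rw [tau, hceil] at hτ
    have h := key 3 (by norm_num) hτ
    have h4 : w ^ (2 * 3) ≤ (3 / 2) ^ (2 * 3) := pow_le_pow_left₀ hw0.le hw5 _
    norm_num at h h4
    nlinarith
  · push_cast
    have : (0 : ℝ) ≤ m := m.cast_nonneg
    nlinarith

end LoopedPath

theorem mainTheorem3 (n : ℕ) (hn : 2 ≤ n) (w : ℝ) (hw : Real.sqrt 2 ≤ w)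
    (hτ : 2 ≤ w + 1 / w - LoopedPath.tau n w) (k : ℕ) :
    LoopedPath.eigenvalue n w ⟨1, by omega⟩ < LoopedPath.eigenvalue n w ⟨0, by omega⟩ ∧
    ((w ^ 2 - 2) / w ^ 2) ^ 2 ≤
      LoopedPath.fidelity n w ⟨0, by omega⟩ ⟨n - 1, by omega⟩
        ((2 * (k : ℝ) + 1) * Real.pi /
          (LoopedPath.eigenvalue n w ⟨0, by omega⟩ -
            LoopedPath.eigenvalue n w ⟨1, by omega⟩)) := by
  obtain ⟨m, rfl⟩ := Nat.exists_eq_add_of_le' hn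
  have hw2 : 2 ≤ w ^ 2 := (Real.sqrt_le_left (by linarith [Real.sqrt_nonneg 2])).1 hw
  have hw1 : 1 < w := lt_of_lt_of_le (Real.lt_sqrt_of_sq_lt (by norm_num)) hw
  have htop : LoopedPath.HasTopPair m w := by
    rcases m with _ | _ | m
    · exact LoopedPath.hasTopPair_zero
    · exact LoopedPath.hasTopPair_one hw1
    · exact LoopedPath.hasTopPair_of_lt hw1 (LoopedPath.lt_of_tau hw hτ)
  obtain ⟨l₁, l₂, z, y, hz, hy, hz0, hy0, hzl, hyl, hl, hμ, hp⟩ := htop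
  obtain ⟨e0, e1⟩ := LoopedPath.eigenvalue_zero_one hz hy (fun h => hz0 (by simp [h]))
    (fun h => hy0 (by simp [h])) hl hμ
  change LoopedPath.eigenvalue (m + 2) w 1 < LoopedPath.eigenvalue (m + 2) w 0 ∧
    _ ≤ LoopedPath.fidelity (m + 2) w 0 (Fin.last _) (_ / (LoopedPath.eigenvalue (m + 2) w 0 -
      LoopedPath.eigenvalue (m + 2) w 1))
  rw [e0, e1]
  refine ⟨hl, ?_⟩
  have h := LoopedPath.fidelity_lower_bound hz hy hz0 hy0 hzl hyl hl k _
    (div_mul_cancel₀ ((2 * (k : ℝ) + 1) * Real.pi) (sub_pos.2 hl).ne')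
  refine pow_le_pow_left₀ (div_nonneg (by linarith) (by positivity)) (le_trans ?_ h) 2
  have : (w ^ 2 - 2) / w ^ 2 = 2 * (1 - 1 / w ^ 2) - 1 := by field_simp; ring
  rw [this]
  linarith
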